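/- Consider the two-stage stochastic linear program $\min_{x\in X}\mathbb{E}[F(x,\boldsymbol\xi)]$ with $F(x,\xi)=c^Tx+Q(x,\xi)$, where $X=\{x\in\mathbb{R}^{n_1}:Ax\le b\}$, $A\in\mathbb{R}^{m_1\times n_1}$, and $$Q(x,\xi)=\min\{q(\xi)^Ty:\ y\in\mathbb{R}^{n_2},\ W(\xi)y\ge h(\xi)-T(\xi)x\}\qquad(Q(x,\xi)=+\infty\text{ if infeasible}).$$ The $m_2$ second-stage constraints are split into random ones, indexed by $I$ (rows $\overline W(\xi)y\ge\overline h(\xi)-\overline T(\xi)x$), and deterministic ones ($Dy\ge d-Cx$); the data $q,\overline W,\overline T,\overline h$ are measurable functions of $\xi$. Assume that $m_2\ge n_2+1$ and that for every $x\in X$ there is $y$ with $Dy\ge d-Cx$. The recourse likelihood of $x$ is $\phi(x)=\mathbb{P}(F(x,\boldsymbol\xi)<+\infty)$. Let $\xi^1,\dots,\xi^N$ be an i.i.d. sample of $\boldsymbol\xi$, with law $\mathbb{P}^N$, and let $N\ge n_1$. Put $P(\xi)=\{\alpha\in\mathbb{R}^{m_2}_+:W(\xi)^T\alpha=q(\xi)\}$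 and $\bar P(\xi)=\{\alpha\in\mathbb{R}^{m_2}_+:W(\xi)^T\alpha=0,\ \sum_{i\in I}\alpha_i=1\}$, and let $\mathrm{EXT}$ denote the set of extreme points. The Benders linear program of the sample average approximation (SAA) is $$\min_{x\in\mathbb{R}^{n_1},\,\Theta\in\mathbb{R}^N} c^Tx+\frac1N\sum_{j=1}^N\Theta_j$$ subject to $\Theta_j\ge\alpha^T(h(\xi^j)-T(\xi^j)x)$ for $\alpha\in\mathrm{EXT}(P(\xi^j))$ and $1\le j\le N$; $\ \alpha^T(h(\xi^j)-T(\xi^j)x)\le0$ for $\alpha\in\mathrm{EXT}(\bar P(\xi^j))$ and $1\le j\le N$; and $Ax\le b$. A basic solution of a system of linear inequalities in $n$ variables is a point at which $n$ inequalities of the system with linearly independent coefficient vectors hold with equality. A point $x$ is a basic optimal solution of the SAA if $Q(x,\xi^j)$ is finite for all $j$ and $(x,(Q(x,\xi^j))_{j})$ is an optimal solution of the Benders linear program that is also a basic solution of its constraint system. Assume that, for almost every sample, $x_N^*=x_N^*(\xi^1,\dots,\xi^N)$ is a basic optimal solution of the SAA. Then for every $\epsilon\in(0,1)$ $$\mathbb{P}^N\big(\phi(x_N^*)\ge1-\epsilon\big)\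 \ge\ 1-\binom{N}{n_1}\frac1{n_1!}(2n_1+m_1)^{n_1}\Big(\frac{m_2^{n_2+1}}{(n_2+1)!}\Big)^{2n_1}(1-\epsilon)^{N-n_1},$$ or equivalently $\mathbb{P}^N(\phi(x_N^*)<1-\epsilon)$ is at most the subtracted term. (If $x_N^*$ is not chosen measurably, the probabilities are outer measures and both inequalities hold.) -/

import Mathlib

open MeasureTheory
open scoped Matrix

/-- A linear inequality `∑ v, normal v * z v ≤ rhs` in the real variables `z v`, `v : V`. -/
structure LinConstraint (V : Type*) where
  normal : V → ℝ
  rhs : ℝ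

namespace LinConstraint

variable {V : Type*} [Fintype V]

/-- The solution set of a system of linear inequalities. -/
def feasibleSet (S : Set (LinConstraint V)) : Set (V → ℝ) :=
  {z | ∀ k ∈ S, k.normal ⬝ᵥ z ≤ k.rhs}

/-- `z` is a basic solution of the system `S` (not necessarily a feasible one): there are as many
constraints of `S` as there are variables, with linearly independent normals, all of which
hold at `z` with equality; `z` is then the unique solution of these equations. -/
def IsBasicSolution (S : Set (LinConstraint V)) (z : V → ℝ) : Prop :=
  ∃ B : Finset (LinConstraint V), (B : Set (LinConstraint V)) ⊆ S ∧ B.card = Fintype.card V ∧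
    LinearIndependent ℝ (fun k : B => (k : LinConstraint V).normal) ∧
    ∀ k ∈ B, k.normal ⬝ᵥ z = k.rhs

/-- `z` is a basic optimal solution of the linear program `min {obj z : z satisfies S}`. -/
def IsBasicOptimalSolution (S : Set (LinConstraint V)) (obj : (V → ℝ) → ℝ) (z : V → ℝ) : Prop :=
  IsBasicSolution S z ∧ z ∈ feasibleSet S ∧ IsMinOn obj (feasibleSet S) z

end LinConstraint

/-- The data of a two-stage stochastic linear program with scenario space `Ξ`:
`n₁` first-stage variables with the `m₁` constraints `A x ≤ b`, first-stage cost `c`, and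
`n₂` second-stage variables with cost `q ξ` and two groups of constraints,
`r` random ones `Wbar ξ y ≥ hbar ξ - Tbar ξ x` and `s` deterministic ones `D y ≥ d - C x`. -/
structure TwoStageLP (Ξ : Type*) (n₁ m₁ n₂ r s : ℕ) where
  A : Matrix (Fin m₁) (Fin n₁) ℝ
  b : Fin m₁ → ℝ
  c : Fin n₁ → ℝ
  q : Ξ → Fin n₂ → ℝ
  Wbar : Ξ → Matrix (Fin r) (Fin n₂) ℝ
  Tbar : Ξ → Matrix (Fin r) (Fin n₁) ℝ
  hbar : Ξ → Fin r → ℝ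
  D : Matrix (Fin s) (Fin n₂) ℝ
  C : Matrix (Fin s) (Fin n₁) ℝ
  d : Fin s → ℝ

namespace TwoStageLP

variable {Ξ : Type*} {n₁ m₁ n₂ r s : ℕ} (L : TwoStageLP Ξ n₁ m₁ n₂ r s)

/-- The first-stage feasible region `X = {x : A x ≤ b}`. -/
def X : Set (Fin n₁ → ℝ) := {x | L.A *ᵥ x ≤ L.b}

/-- The full second-stage matrix `W(ξ)`, with `r + s` rows. -/
def W (ξ : Ξ) : Matrix (Fin r ⊕ Fin s) (Fin n₂) ℝ := Matrix.fromRows (L.Wbar ξ) L.D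

/-- The full technology matrix `T(ξ)`. -/
def T (ξ : Ξ) : Matrix (Fin r ⊕ Fin s) (Fin n₁) ℝ := Matrix.fromRows (L.Tbar ξ) L.C

/-- The full second-stage right-hand side `h(ξ)`. -/
def h (ξ : Ξ) : Fin r ⊕ Fin s → ℝ := Sum.elim (L.hbar ξ) L.d

/-- The second-stage value `Q(x,ξ) = min {q(ξ)ᵀ y : W(ξ) y ≥ h(ξ) - T(ξ) x}`; it is `⊤` if there is
no feasible recourse action. -/
noncomputable def Q (x : Fin n₁ → ℝ) (ξ : Ξ) : EReal :=
  ⨅ y ∈ {y : Fin n₂ → ℝ | L.h ξ - L.T ξ *ᵥ x ≤ L.W ξ *ᵥ y}, ((L.q ξ ⬝ᵥ y : ℝ) : EReal)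

/-- `F(x,ξ) = cᵀ x + Q(x,ξ)`. -/
noncomputable def F (x : Fin n₁ → ℝ) (ξ : Ξ) : EReal := ((L.c ⬝ᵥ x : ℝ) : EReal) + L.Q x ξ

/-- The recourse likelihood `φ(x)`: the probability that `F(x,ξ) < ∞`. -/
noncomputable def recourseLikelihood [MeasurableSpace Ξ] (P : Measure Ξ) (x : Fin n₁ → ℝ) : ℝ :=
  P.real {ξ | L.F x ξ < ⊤}

/-- The dual feasible set `P(ξ) = {α ≥ 0 : W(ξ)ᵀ α = q(ξ)}` of the second stage. -/
def dualPolyhedron (ξ : Ξ) : Set (Fin r ⊕ Fin s → ℝ) :=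
  {α | 0 ≤ α ∧ (L.W ξ)ᵀ *ᵥ α = L.q ξ}

/-- The polyhedron `{α ≥ 0 : W(ξ)ᵀ α = 0, ∑_{i random} α i = 1}` of the feasibility cuts. -/
def feasPolyhedron (ξ : Ξ) : Set (Fin r ⊕ Fin s → ℝ) :=
  {α | 0 ≤ α ∧ (L.W ξ)ᵀ *ᵥ α = 0 ∧ ∑ i : Fin r, α (Sum.inl i) = 1}

/-- The optimality cut `Θ_j ≥ αᵀ (h(ξ) - T(ξ) x)` in the variables `(x, Θ)`. -/
def optCut {N : ℕ} (j : Fin N) (ξ : Ξ) (α : Fin r ⊕ Fin s → ℝ) : LinConstraint (Fin n₁ ⊕ Fin N) where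
  normal := Sum.elim (-((L.T ξ)ᵀ *ᵥ α)) (-Pi.single j 1)
  rhs := -(α ⬝ᵥ L.h ξ)

/-- The feasibility cut `αᵀ (h(ξ) - T(ξ) x) ≤ 0` in the variables `(x, Θ)`. -/
def feasCut (N : ℕ) (ξ : Ξ) (α : Fin r ⊕ Fin s → ℝ) : LinConstraint (Fin n₁ ⊕ Fin N) where
  normal := Sum.elim (-((L.T ξ)ᵀ *ᵥ α)) 0
  rhs := -(α ⬝ᵥ L.h ξ)

/-- The `i`-th row of `A x ≤ b` in the variables `(x, Θ)`. -/
def firstStageCut (N : ℕ) (i : Fin m₁) : LinConstraint (Fin n₁ ⊕ Fin N) where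
  normal := Sum.elim (L.A i) 0
  rhs := L.b i

/-- The constraints of the Benders formulation of the sample average approximation with the
sample `ξ^1, …, ξ^N`. -/
def bendersSystem {N : ℕ} (ξs : Fin N → Ξ) : Set (LinConstraint (Fin n₁ ⊕ Fin N)) :=
  {k | ∃ j, ∃ α ∈ (L.dualPolyhedron (ξs j)).extremePoints ℝ, k = L.optCut j (ξs j) α} ∪
  {k | ∃ j, ∃ α ∈ (L.feasPolyhedron (ξs j)).extremePoints ℝ, k = L.feasCut N (ξs j) α} ∪
  Set.range (L.firstStageCut N)

/-- The Benders objective `cᵀ x + N⁻¹ ∑_j Θ_j`. -/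
noncomputable def bendersObjective (N : ℕ) (z : Fin n₁ ⊕ Fin N → ℝ) : ℝ :=
  L.c ⬝ᵥ (z ∘ Sum.inl) + (N : ℝ)⁻¹ * ∑ j : Fin N, z (Sum.inr j)

/-- `x` is a basic optimal solution of the sample average approximation with sample `ξs`:
`Q(x,ξ^j)` is finite for all `j`, and `(x, (Q(x,ξ^j))_j)` is a basic optimal solution of the
Benders linear program. -/
def IsSAABasicOptimal {N : ℕ} (ξs : Fin N → Ξ) (x : Fin n₁ → ℝ) : Prop :=
  ∃ Θ : Fin N → ℝ, (∀ j, L.Q x (ξs j) = (Θ j : EReal)) ∧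
    LinConstraint.IsBasicOptimalSolution (L.bendersSystem ξs) (L.bendersObjective N)
      (Sum.elim x Θ)

/-- The random data depend measurably on the scenario. -/
structure MeasurableData [MeasurableSpace Ξ] : Prop where
  q : ∀ k, Measurable fun ξ => L.q ξ k
  Wbar : ∀ i k, Measurable fun ξ => L.Wbar ξ i k
  Tbar : ∀ i k, Measurable fun ξ => L.Tbar ξ i k
  hbar : ∀ i, Measurable fun ξ => L.hbar ξ i

end TwoStageLP

/-- The bound `C(N,n₁) (1/n₁!) (2n₁+m₁)^{n₁} (m₂^{n₂+1}/(n₂+1)!)^{2n₁} (1-ε)^{N-n₁}` on the failure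
probability (used for `n₁ ≤ N`). -/
noncomputable def saaFailureBound (N n₁ m₁ n₂ m₂ : ℕ) (ε : ℝ) : ℝ :=
  (N.choose n₁ : ℝ) * (1 / (n₁.factorial : ℝ)) * (2 * (n₁ : ℝ) + (m₁ : ℝ)) ^ n₁ *
    ((m₂ : ℝ) ^ (n₂ + 1) / ((n₂ + 1).factorial : ℝ)) ^ (2 * n₁) * (1 - ε) ^ (N - n₁)

/-!
A basic solution of the Benders program determines its first-stage part `x` by few scenarios. Each
tight optimality cut of scenario `j` involves the single auxiliary variable `Θ j`, so two tight
cuts of the same scenario may be subtracted and `Θ` eliminated: `x` is a basic solution of the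
system `reducedSystem` in the `n₁` first-stage variables, which consists of these differences, the
feasibility cuts and the rows of `A x ≤ b`, the extreme points defining the cuts being replaced by
the more numerous basic solutions `equationBasicSolutions` (`isBasicSolution_reducedSystem`). Each
of the `n₁` linearly independent constraints that determine `x` involves at most one scenario,
hence `x` is one of the basic solutions of the reduced system of some `n₁` scenarios `J`
(`exists_isBasicSolution_reducedSystem_restrict`).

With `M = m₂ ^ (n₂ + 1) / (n₂ + 1)!`, every scenario has at most `M` cuts of each kind
(`finite_equationBasicSolutions_and_ncard_le`; this uses `n₂ + 1 ≤ m₂`), so that the reduced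
system of `J` has at most `K = (2 n₁ + m₁) M ^ 2` constraints and at most `K.choose n₁ ≤ K ^ n₁ /
n₁!` basic solutions. These candidates depend only on the scenarios in `J`. If a candidate `x` has
recourse likelihood below `1 - ε`, the other `N - n₁` scenarios, being independent of it, all
admit a recourse action for `x` with probability at most `(1 - ε) ^ (N - n₁)`, and admitting one
is necessary for `Q(x, ξ^j)` to be finite. The union bound over `J` and over the candidates
finishes the proof.

Conditioning on the scenarios in `J` requires the set of bad samples to be measurable, although
`xstar` is not assumed to be. The candidates are therefore listed by countably many measurable
functions (`HasMeasurableEnumeration`), which Cramer's rule provides, whereas their number is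
bounded for each sample separately (`prod_setOf_exists_le`): the list itself may be much longer,
as it has to cater for all possible ranks of the data. Feasibility of `(x, ξ)` is a measurable
condition because it is an `F_σ` condition on the coefficients (`measurableSet_exists_le_mulVec`).
-/

/-! ### Basic solutions of linear systems -/

/-- Vectors with trivial orthogonal complement span the whole space. -/
theorem span_range_eq_top_of_dotProduct {V ι : Type*} [Fintype V] (w : ι → V → ℝ)
    (hw : ∀ u : V → ℝ, (∀ i, w i ⬝ᵥ u = 0) → u = 0) :
    Submodule.span ℝ (Set.range w) = ⊤ := by
  classical
  by_contra hne
  obtain ⟨f, hf0, hf⟩ := Submodule.exists_le_ker_of_lt_top _ (lt_top_iff_ne_top.mpr hne)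
  have key : ∀ x : V → ℝ, f x = x ⬝ᵥ fun v => f (Pi.single v 1) := fun x => by
    conv_lhs => rw [← Finset.univ_sum_single x]
    rw [map_sum, dotProduct]
    refine Finset.sum_congr rfl fun v _ => ?_
    rw [show (Pi.single v (x v) : V → ℝ) = x v • Pi.single v 1 by
      rw [← Pi.single_smul, smul_eq_mul, mul_one], map_smul, smul_eq_mul]
  have hu := hw (fun v => f (Pi.single v 1)) fun i => by
    rw [← key]
    exact hf (Submodule.subset_span ⟨i, rfl⟩)
  exact hf0 (LinearMap.ext fun x => by rw [key, hu]; simp)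

namespace LinConstraint

section

variable {V : Type*} [Fintype V]

/-- The constraints witnessing a basic solution may be indexed by the variables. -/
theorem isBasicSolution_iff_exists_family (S : Set (LinConstraint V)) (z : V → ℝ) :
    IsBasicSolution S z ↔ ∃ c : V → LinConstraint V, (∀ v, c v ∈ S) ∧
      LinearIndependent ℝ (fun v => (c v).normal) ∧ ∀ v, (c v).normal ⬝ᵥ z = (c v).rhs := by
  classical
  constructor
  · rintro ⟨B, hBS, hcard, hli, ht⟩
    have e : V ≃ B := (Fintype.equivOfCardEq (by rw [Fintype.card_coe, hcard])).symm
    exact ⟨fun v => e v, fun v => hBS (e v).2, hli.comp e e.injective, fun v => ht _ (e v).2⟩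
  · rintro ⟨c, hcS, hli, ht⟩
    have hinj : Function.Injective c := fun v w h =>
      hli.injective (congrArg LinConstraint.normal h)
    refine ⟨Finset.univ.image c, ?_, ?_, ?_, ?_⟩
    · intro k hk
      obtain ⟨v, -, rfl⟩ := Finset.mem_image.mp (Finset.mem_coe.mp hk)
      exact hcS v
    · rw [Finset.card_image_of_injective _ hinj, Finset.card_univ]
    · have hg : ∀ k : (Finset.univ.image c : Finset _), ∃ v, c v = k := fun k => by
        obtain ⟨v, -, h⟩ := Finset.mem_image.mp k.2
        exact ⟨v, h⟩
      choose g hg using hg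
      have := hli.comp g fun k l h => Subtype.ext (by rw [← hg k, ← hg l, h])
      simpa only [Function.comp_def, hg] using this
    · intro k hk
      obtain ⟨v, -, rfl⟩ := Finset.mem_image.mp hk
      exact ht v

/-- A point is a basic solution iff only the zero vector is orthogonal to the normals of all
constraints that are tight there. -/
theorem isBasicSolution_iff_forall_orthogonal (S : Set (LinConstraint V)) (z : V → ℝ) :
    IsBasicSolution S z ↔
      ∀ u : V → ℝ, (∀ k ∈ S, k.normal ⬝ᵥ z = k.rhs → k.normal ⬝ᵥ u = 0) → u = 0 := by
  classical
  rw [isBasicSolution_iff_exists_family]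
  constructor
  · rintro ⟨c, hcS, hli, ht⟩ u hu
    have hunit : IsUnit (Matrix.of fun v => (c v).normal) :=
      Matrix.linearIndependent_rows_iff_isUnit.mp hli
    refine Matrix.mulVec_injective_of_isUnit hunit ?_
    rw [Matrix.mulVec_zero]
    exact funext fun v => hu _ (hcS v) (ht v)
  · intro h
    let w : {k // k ∈ S ∧ k.normal ⬝ᵥ z = k.rhs} → V → ℝ := fun k => k.1.normal
    have hspan := span_range_eq_top_of_dotProduct w fun u hu =>
      h u fun k hk ht => hu ⟨k, hk, ht⟩
    obtain ⟨κ, a, -, hs, hli⟩ := exists_linearIndependent' ℝ w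
    let e : V ≃ κ :=
      (Pi.basisFun ℝ V).indexEquiv (Module.Basis.mk hli (by rw [hs, hspan]))
    exact ⟨fun v => (a (e v)).1, fun v => (a (e v)).2.1, hli.comp e e.injective,
      fun v => (a (e v)).2.2⟩

/-- A finite system in `n` variables has at most as many basic solutions as it has subsystems of
size `n`. -/
theorem finite_isBasicSolution_and_ncard_le {S : Set (LinConstraint V)} (hS : S.Finite) :
    {z | IsBasicSolution S z}.Finite ∧
      {z | IsBasicSolution S z}.ncard ≤ S.ncard.choose (Fintype.card V) := by
  classical
  let f : (V → ℝ) → Finset (LinConstraint V) := fun z =>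
    if h : IsBasicSolution S z then h.choose else ∅
  have hf : ∀ z, (h : IsBasicSolution S z) → f z = h.choose := fun z h => dif_pos h
  let T : Finset (Finset (LinConstraint V)) := hS.toFinset.powersetCard (Fintype.card V)
  have hmaps : ∀ z ∈ {z | IsBasicSolution S z}, f z ∈ (T : Set (Finset (LinConstraint V))) := by
    intro z (hz : IsBasicSolution S z)
    rw [hf z hz, Finset.mem_coe, Finset.mem_powersetCard]
    exact ⟨fun k hk => hS.mem_toFinset.mpr (hz.choose_spec.1 hk), hz.choose_spec.2.1⟩
  have hinj : Set.InjOn f {z | IsBasicSolution S z} := by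
    intro z (hz : IsBasicSolution S z) z' (hz' : IsBasicSolution S z') h
    rw [hf z hz, hf z' hz'] at h
    obtain ⟨-, h2, h3, h4⟩ := hz.choose_spec
    have ht' := hz'.choose_spec.2.2.2
    rw [← h] at ht'
    have hb : IsBasicSolution (hz.choose : Set (LinConstraint V)) z :=
      ⟨_, subset_rfl, h2, h3, h4⟩
    refine sub_eq_zero.mp ((isBasicSolution_iff_forall_orthogonal _ _).mp hb _ fun k hk _ => ?_)
    rw [dotProduct_sub, h4 k hk, ht' k hk, sub_self]
  refine ⟨Set.Finite.of_injOn hmaps hinj T.finite_toSet, ?_⟩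
  refine (Set.ncard_le_ncard_of_injOn f hmaps hinj T.finite_toSet).trans ?_
  rw [Set.ncard_coe_finset, Finset.card_powersetCard, Set.ncard_eq_toFinset_card S hS]

end

end LinConstraint

/-! ### Basic solutions of equations in nonnegative variables -/

section

variable {K I : Type*} [Fintype I]

/-- The basic solutions of `M α = p`, without sign constraint: solutions such that the columns of
`M` belonging to the support of `α` are linearly independent, i.e. no nonzero element of the
kernel of `M` is supported in the support of `α`. -/
def equationBasicSolutions (M : Matrix K I ℝ) (p : K → ℝ) : Set (I → ℝ) :=
  {α | M *ᵥ α = p ∧ ∀ u, M *ᵥ u = 0 → (∀ i, α i = 0 → u i = 0) → u = 0}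

/-- At an extreme point of `{α ≥ 0 : M α = p}` no kernel direction is supported in the support of
the point, since a small step along it in either direction would stay in the polyhedron. -/
theorem extremePoints_subset_equationBasicSolutions (M : Matrix K I ℝ) (p : K → ℝ) :
    Set.extremePoints ℝ {α : I → ℝ | 0 ≤ α ∧ M *ᵥ α = p} ⊆ equationBasicSolutions M p := by
  intro α hα
  obtain ⟨⟨hα0, hαp⟩, hext⟩ := mem_extremePoints.mp hα
  refine ⟨hαp, fun u hu hsupp => ?_⟩
  -- a small multiple of `u` can be added to and subtracted from `α`
  obtain ⟨δ, hδ, hδ0⟩ : ∃ δ : ℝ, (∀ i, δ * |u i| ≤ α i) ∧ 0 < δ := by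
    have h : ∀ᶠ δ : ℝ in nhdsWithin 0 (Set.Ioi 0), ∀ i, δ * |u i| ≤ α i := by
      refine Filter.eventually_all.mpr fun i => ?_
      by_cases hi : α i = 0
      · simp [hi, hsupp i hi]
      · have hc : Filter.Tendsto (fun δ : ℝ => δ * |u i|) (nhdsWithin 0 (Set.Ioi 0))
            (nhds 0) := by
          have : Continuous fun δ : ℝ => δ * |u i| := by fun_prop
          simpa using (this.tendsto 0).mono_left nhdsWithin_le_nhds
        exact (hc.eventually_lt_const (lt_of_le_of_ne (hα0 i) (Ne.symm hi))).mono
          fun _ h => h.le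
    exact (h.and self_mem_nhdsWithin).exists
  have hmem : ∀ t : ℝ, |t| = δ → α + t • u ∈ {α : I → ℝ | 0 ≤ α ∧ M *ᵥ α = p} := by
    intro t ht
    refine ⟨fun i => ?_, by
      rw [Matrix.mulVec_add, Matrix.mulVec_smul, hu, smul_zero, add_zero, hαp]⟩
    have h1 := hδ i
    rw [← ht, ← abs_mul] at h1
    have h2 := neg_abs_le (t * u i)
    simp only [Pi.zero_apply, Pi.add_apply, Pi.smul_apply, smul_eq_mul]
    linarith
  have h1 := hmem δ (abs_of_pos hδ0)
  have h2 := hmem (-δ) (by rw [abs_neg, abs_of_pos hδ0])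
  have := (hext _ h1 _ h2 ⟨1 / 2, 1 / 2, by norm_num, by norm_num, by norm_num, by
    ext i
    simp
    ring⟩).1
  have h0 : δ • u = 0 := by simpa using this
  exact (smul_eq_zero.mp h0).resolve_left hδ0.ne'

theorem pow_div_factorial_mono_of_le {m k l : ℕ} (hkl : k ≤ l) (hl : l ≤ m) :
    (m : ℝ) ^ k / (k.factorial : ℝ) ≤ (m : ℝ) ^ l / (l.factorial : ℝ) := by
  induction l, hkl using Nat.le_induction with
  | base => exact le_rfl
  | succ l _ ih =>
    refine (ih (by omega)).trans ?_
    rw [Nat.factorial_succ, pow_succ, Nat.cast_mul, mul_comm ((l + 1 : ℕ) : ℝ), mul_div_mul_comm]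
    refine le_mul_of_one_le_right (by positivity) ?_
    rw [one_le_div (by positivity)]
    exact_mod_cast hl

/-- The bound `m ^ l / l!` on the number of basic solutions of `k ≤ l` equations in `m ≥ l`
variables. If `ρ` is the rank of the equations, a basic solution is determined by any set of `ρ`
independent columns containing its support. -/
theorem finite_equationBasicSolutions_and_ncard_le [Fintype K] (M : Matrix K I ℝ) (p : K → ℝ)
    {l : ℕ} (hkl : Fintype.card K ≤ l) (hl : l ≤ Fintype.card I) :
    (equationBasicSolutions M p).Finite ∧
      ((equationBasicSolutions M p).ncard : ℝ) ≤
        (Fintype.card I : ℝ) ^ l / (l.factorial : ℝ) := by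
  classical
  have hmul : ∀ u : I → ℝ, M *ᵥ u = ∑ i, u i • M.col i := fun u => by
    ext k
    simp [Matrix.mulVec, dotProduct, mul_comm]
  have hex : ∀ α ∈ equationBasicSolutions M p, ∃ B : Finset I, (∀ i, α i ≠ 0 → i ∈ B) ∧
      B.card = Module.finrank ℝ (Submodule.span ℝ (Set.range M.col)) ∧
      LinearIndepOn ℝ M.col (B : Set I) := by
    intro α hα
    have hli : LinearIndepOn ℝ M.col {i | α i ≠ 0} := by
      rw [show {i | α i ≠ 0} = ((Finset.univ.filter fun i => α i ≠ 0 : Finset I) : Set I) by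
        simp, linearIndepOn_finset_iff]
      intro g hg i hi
      have h0 := hα.2 (fun i => if α i = 0 then 0 else g i) (by
        rw [hmul, ← hg, Finset.sum_filter]
        refine Finset.sum_congr rfl fun i _ => ?_
        by_cases h : α i = 0 <;> simp [h]) (fun i h => by simp [h])
      have := congrFun h0 i
      simpa [(Finset.mem_filter.mp hi).2] using this
    obtain ⟨b, -, hsb, hspan, hb⟩ := exists_linearIndepOn_extension hli (Set.subset_univ _)
    refine ⟨b.toFinset, fun i hi => Set.mem_toFinset.mpr (hsb hi), ?_, by simpa using hb⟩
    have hs : Submodule.span ℝ (Set.range M.col) = Submodule.span ℝ (M.col '' b) := by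
      refine le_antisymm (Submodule.span_le.mpr (by simpa using hspan)) ?_
      exact Submodule.span_mono (Set.image_subset_range _ _)
    rw [hs, Set.image_eq_range, finrank_span_eq_card hb, Set.toFinset_card]
  choose! f hf1 hf2 hf3 using hex
  set ρ := Module.finrank ℝ (Submodule.span ℝ (Set.range M.col)) with hρ
  let T : Finset (Finset I) := Finset.univ.powersetCard ρ
  have hmaps : ∀ α ∈ equationBasicSolutions M p, f α ∈ (T : Set (Finset I)) := fun α hα => by
    simpa [T, Finset.mem_powersetCard] using hf2 α hα
  have hinj : Set.InjOn f (equationBasicSolutions M p) := by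
    intro α hα β hβ h
    have hz : ∀ i, i ∉ f α → α i = 0 ∧ β i = 0 := fun i hi =>
      ⟨by_contra fun h' => hi (hf1 α hα i h'), by_contra fun h' => hi (h ▸ hf1 β hβ i h')⟩
    have h0 := linearIndepOn_finset_iff.mp (hf3 α hα) (fun i => α i - β i) (by
      rw [Finset.sum_subset (Finset.subset_univ _) fun i _ hi => by simp [hz i hi]]
      rw [← hmul, show (fun i => α i - β i) = α - β from rfl, Matrix.mulVec_sub, hα.1, hβ.1,
        sub_self])
    ext i
    by_cases hi : i ∈ f α
    · exact sub_eq_zero.mp (h0 i hi)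
    · rw [(hz i hi).1, (hz i hi).2]
  refine ⟨Set.Finite.of_injOn hmaps hinj T.finite_toSet, ?_⟩
  have h1 := Set.ncard_le_ncard_of_injOn f hmaps hinj T.finite_toSet
  rw [Set.ncard_coe_finset, Finset.card_powersetCard, Finset.card_univ] at h1
  have hρl : ρ ≤ l := by
    refine (Submodule.finrank_le _).trans ?_
    rwa [Module.finrank_fintype_fun_eq_card]
  calc ((equationBasicSolutions M p).ncard : ℝ)
      ≤ ((Fintype.card I).choose ρ : ℝ) := by exact_mod_cast h1
    _ ≤ (Fintype.card I : ℝ) ^ ρ / (ρ.factorial : ℝ) := Nat.choose_le_pow_div _ _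
    _ ≤ _ := pow_div_factorial_mono_of_le hρl hl

end

/-! ### Measurably enumerated families of sets -/

/-- A set-valued map `S` whose values are countable and are listed by countably many measurable
functions `g i`, the `i`-th of which counts only on the measurable set `v i`. -/
def HasMeasurableEnumeration {Ω E : Type*} [MeasurableSpace Ω] [MeasurableSpace E]
    (S : Ω → Set E) : Prop :=
  ∃ (ι : Type) (_ : Countable ι) (g : ι → Ω → E) (v : ι → Set Ω), (∀ i, Measurable (g i)) ∧
    (∀ i, MeasurableSet (v i)) ∧ ∀ ω x, x ∈ S ω ↔ ∃ i, ω ∈ v i ∧ g i ω = x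

namespace HasMeasurableEnumeration

variable {Ω Ω' E F : Type*} [MeasurableSpace Ω] [MeasurableSpace Ω'] [MeasurableSpace E]
  [MeasurableSpace F]

theorem singleton {f : Ω → E} (hf : Measurable f) :
    HasMeasurableEnumeration fun ω => {f ω} :=
  ⟨Unit, inferInstance, fun _ => f, fun _ => Set.univ, fun _ => hf, fun _ => .univ, fun ω x => by
    simp [eq_comm]⟩

theorem iUnion {κ : Type} [Countable κ] {S : κ → Ω → Set E}
    (hS : ∀ k, HasMeasurableEnumeration (S k)) :
    HasMeasurableEnumeration fun ω => ⋃ k, S k ω := by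
  choose ι hι g v hg hv h using hS
  refine ⟨Σ k, ι k, inferInstance, fun i => g i.1 i.2, fun i => v i.1 i.2, fun i => hg _ _,
    fun i => hv _ _, fun ω x => ?_⟩
  simp [h]

theorem union {S T : Ω → Set E} (hS : HasMeasurableEnumeration S)
    (hT : HasMeasurableEnumeration T) : HasMeasurableEnumeration fun ω => S ω ∪ T ω := by
  have := iUnion (κ := Bool) (S := fun k => cond k S T) (by rintro (_ | _) <;> assumption)
  convert this using 2 with ω
  rw [Set.union_eq_iUnion]
  exact Set.iUnion_congr fun k => by cases k <;> rfl

theorem comp {S : Ω → Set E} (hS : HasMeasurableEnumeration S) {f : Ω' → Ω}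
    (hf : Measurable f) : HasMeasurableEnumeration fun ω => S (f ω) := by
  obtain ⟨ι, hι, g, v, hg, hv, h⟩ := hS
  exact ⟨ι, hι, fun i ω => g i (f ω), fun i => f ⁻¹' v i, fun i => (hg i).comp hf,
    fun i => hf (hv i), fun ω x => h (f ω) x⟩

theorem bind {S : Ω → Set E} (hS : HasMeasurableEnumeration S) {T : Ω × E → Set F}
    (hT : HasMeasurableEnumeration T) :
    HasMeasurableEnumeration fun ω => {y | ∃ x ∈ S ω, y ∈ T (ω, x)} := by
  obtain ⟨ι, hι, g, v, hg, hv, h⟩ := hS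
  obtain ⟨κ, hκ, g', v', hg', hv', h'⟩ := hT
  have hm : ∀ i, Measurable fun ω => (ω, g i ω) := fun i => measurable_id.prodMk (hg i)
  refine ⟨ι × κ, inferInstance, fun i ω => g' i.2 (ω, g i.1 ω),
    fun i => v i.1 ∩ (fun ω => (ω, g i.1 ω)) ⁻¹' v' i.2, fun i => (hg' _).comp (hm _),
    fun i => (hv _).inter (hm _ (hv' _)), fun ω y => ?_⟩
  simp only [Set.mem_ofPred_eq, h, h', Prod.exists, Set.mem_inter_iff, Set.mem_preimage]
  constructor
  · rintro ⟨x, ⟨i, hi, rfl⟩, j, hj, rfl⟩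
    exact ⟨i, j, ⟨hi, hj⟩, rfl⟩
  · rintro ⟨i, j, ⟨hi, hj⟩, rfl⟩
    exact ⟨_, ⟨i, hi, rfl⟩, j, hj, rfl⟩

theorem image {S : Ω → Set E} (hS : HasMeasurableEnumeration S) {f : Ω × E → F}
    (hf : Measurable f) : HasMeasurableEnumeration fun ω => (fun x => f (ω, x)) '' S ω := by
  have := hS.bind (singleton hf)
  simpa only [Set.mem_singleton_iff, eq_comm, Set.image] using this

theorem sep {S : Ω → Set E} (hS : HasMeasurableEnumeration S) {R : Set (Ω × E)}
    (hR : MeasurableSet R) : HasMeasurableEnumeration fun ω => {x | x ∈ S ω ∧ (ω, x) ∈ R} := by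
  obtain ⟨ι, hι, g, v, hg, hv, h⟩ := hS
  refine ⟨ι, hι, g, fun i => v i ∩ (fun ω => (ω, g i ω)) ⁻¹' R, hg,
    fun i => (hv i).inter ((measurable_id.prodMk (hg i)) hR), fun ω x => ?_⟩
  simp only [Set.mem_ofPred_eq, h, Set.mem_inter_iff, Set.mem_preimage]
  constructor
  · rintro ⟨⟨i, hi, rfl⟩, hR⟩
    exact ⟨i, ⟨hi, hR⟩, rfl⟩
  · rintro ⟨i, ⟨hi, hR⟩, rfl⟩
    exact ⟨⟨i, hi, rfl⟩, hR⟩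

/-- For measurably enumerated sets the projection of a measurable set is measurable. -/
theorem measurableSet_exists {S : Ω → Set E} (hS : HasMeasurableEnumeration S)
    {R : Set (Ω × E)} (hR : MeasurableSet R) : MeasurableSet {ω | ∃ x ∈ S ω, (ω, x) ∈ R} := by
  obtain ⟨ι, hι, g, v, hg, hv, h⟩ := hS
  have : {ω | ∃ x ∈ S ω, (ω, x) ∈ R} = ⋃ i, v i ∩ (fun ω => (ω, g i ω)) ⁻¹' R := by
    ext ω
    simp only [Set.mem_ofPred_eq, h, Set.mem_iUnion, Set.mem_inter_iff, Set.mem_preimage]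
    constructor
    · rintro ⟨x, ⟨i, hi, rfl⟩, hR⟩
      exact ⟨i, hi, hR⟩
    · rintro ⟨i, hi, hR⟩
      exact ⟨_, ⟨i, hi, rfl⟩, hR⟩
  rw [this]
  exact .iUnion fun i => (hv i).inter ((measurable_id.prodMk (hg i)) hR)

end HasMeasurableEnumeration

/-- The union bound: if each of the at most `K` points of the random finite set `S ω` is bad for
an independent `ω'` with probability at most `δ`, some point of `S ω` is bad with probability at
most `K δ`. -/
theorem prod_setOf_exists_le {Ω Ω' E : Type*} [MeasurableSpace Ω] [MeasurableSpace Ω']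
    [MeasurableSpace E] (μ : Measure Ω) [IsProbabilityMeasure μ] (ν : Measure Ω') [SFinite ν]
    {S : Ω → Set E} (hS : HasMeasurableEnumeration S) {R : Set (E × Ω')} (hR : MeasurableSet R)
    {K : ℕ} (hK : ∀ ω, (S ω).Finite ∧ (S ω).ncard ≤ K) {δ : ENNReal}
    (hδ : ∀ x, ν {η | (x, η) ∈ R} ≤ δ) :
    (μ.prod ν) {p | ∃ x ∈ S p.1, (x, p.2) ∈ R} ≤ K * δ := by
  have hm : MeasurableSet {p : Ω × Ω' | ∃ x ∈ S p.1, (x, p.2) ∈ R} :=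
    (hS.comp measurable_fst).measurableSet_exists
      (R := {q : (Ω × Ω') × E | (q.2, q.1.2) ∈ R})
      ((measurable_snd.prodMk (measurable_snd.comp measurable_fst)) hR)
  rw [Measure.prod_apply hm]
  calc ∫⁻ ω, ν (Prod.mk ω ⁻¹' {p | ∃ x ∈ S p.1, (x, p.2) ∈ R}) ∂μ
      ≤ ∫⁻ _, K * δ ∂μ := by
        refine lintegral_mono fun ω => ?_
        obtain ⟨hfin, hcard⟩ := hK ω
        have hsub : Prod.mk ω ⁻¹' {p : Ω × Ω' | ∃ x ∈ S p.1, (x, p.2) ∈ R} ⊆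
            ⋃ x ∈ hfin.toFinset, {η | (x, η) ∈ R} := by
          rintro η ⟨x, hx, hxη⟩
          exact Set.mem_biUnion (by simpa using hx) hxη
        calc ν _ ≤ ∑ x ∈ hfin.toFinset, ν {η | (x, η) ∈ R} :=
              (measure_mono hsub).trans (measure_biUnion_finset_le _ _)
          _ ≤ hfin.toFinset.card * δ := by
              rw [← nsmul_eq_mul]
              exact Finset.sum_le_card_nsmul _ _ _ fun x _ => hδ x
          _ ≤ K * δ := by
              rw [← Set.ncard_eq_toFinset_card _ hfin]
              gcongr
    _ = K * δ := by simp

/-- Cramer's rule for a square system. -/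
theorem Matrix.mulVec_eq_iff_of_det_ne_zero {V : Type*} [Fintype V] [DecidableEq V]
    {M : Matrix V V ℝ} (hM : M.det ≠ 0) {z b : V → ℝ} :
    M *ᵥ z = b ↔ M.det⁻¹ • (M.adjugate *ᵥ b) = z := by
  constructor
  · rintro rfl
    rw [Matrix.mulVec_mulVec, Matrix.adjugate_mul, Matrix.smul_mulVec, Matrix.one_mulVec,
      inv_smul_smul₀ hM]
  · rintro rfl
    rw [Matrix.mulVec_smul, Matrix.mulVec_mulVec, Matrix.mul_adjugate, Matrix.smul_mulVec,
      Matrix.one_mulVec, inv_smul_smul₀ hM]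

namespace LinConstraint

/-- Linear constraints are identified with pairs of a normal vector and a right-hand side. -/
instance {V : Type*} : MeasurableSpace (LinConstraint V) :=
  MeasurableSpace.comap (fun k => (k.normal, k.rhs)) inferInstance

theorem measurable_normal_rhs {V : Type*} :
    Measurable fun k : LinConstraint V => (k.normal, k.rhs) :=
  comap_measurable _

theorem measurable_mk {Ω V : Type*} [MeasurableSpace Ω] {a : Ω → V → ℝ} {b : Ω → ℝ}
    (ha : Measurable a) (hb : Measurable b) : Measurable fun ω => LinConstraint.mk (a ω) (b ω) :=
  measurable_comap_iff.mpr (ha.prodMk hb)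

/-- Basic solutions of a measurably enumerated system are measurably enumerated, because
Cramer's rule gives them as rational functions of the coefficients of the tight constraints. -/
theorem hasMeasurableEnumeration_isBasicSolution {Ω : Type*} [MeasurableSpace Ω] {V : Type}
    [Fintype V] {S : Ω → Set (LinConstraint V)} (hS : HasMeasurableEnumeration S) :
    HasMeasurableEnumeration fun ω => {z | IsBasicSolution (S ω) z} := by
  classical
  obtain ⟨ι, hι, g, v, hg, hv, h⟩ := hS
  have hn : ∀ i, Measurable fun ω => (g i ω).normal := fun i =>
    measurable_fst.comp (measurable_normal_rhs.comp (hg i))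
  have hr : ∀ i, Measurable fun ω => (g i ω).rhs := fun i =>
    measurable_snd.comp (measurable_normal_rhs.comp (hg i))
  let A : (V → ι) → Ω → V → V → ℝ := fun f ω w => (g (f w) ω).normal
  let b : (V → ι) → Ω → V → ℝ := fun f ω w => (g (f w) ω).rhs
  have hA : ∀ f, Measurable (A f) := fun f => measurable_pi_iff.mpr fun w => hn (f w)
  have hb : ∀ f, Measurable (b f) := fun f => measurable_pi_iff.mpr fun w => hr (f w)
  have hdet : Measurable fun M : V → V → ℝ => (Matrix.of M).det := by
    have : Continuous fun M : V → V → ℝ => (Matrix.of M).det :=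
      Continuous.matrix_det continuous_id
    exact this.measurable
  have hsol : Measurable fun q : (V → V → ℝ) × (V → ℝ) =>
      (Matrix.of q.1).det⁻¹ • ((Matrix.of q.1).adjugate *ᵥ q.2) := by
    have h1 : Continuous fun q : (V → V → ℝ) × (V → ℝ) => Matrix.of q.1 := continuous_fst
    have : Continuous fun q : (V → V → ℝ) × (V → ℝ) => (Matrix.of q.1).adjugate *ᵥ q.2 :=
      h1.matrix_adjugate.matrix_mulVec continuous_snd
    exact (hdet.comp measurable_fst).inv.smul this.measurable
  refine ⟨V → ι, inferInstance,
    fun f ω => ((Matrix.of (A f ω)).det)⁻¹ • ((Matrix.of (A f ω)).adjugate *ᵥ b f ω),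
    fun f => (⋂ w, v (f w)) ∩ (fun ω => (Matrix.of (A f ω)).det) ⁻¹' {0}ᶜ, fun f => ?_,
    fun f => ?_, fun ω z => ?_⟩
  · exact hsol.comp ((hA f).prodMk (hb f))
  · exact (MeasurableSet.iInter fun w => hv _).inter
      ((hdet.comp (hA f)) (measurableSet_singleton 0).compl)
  · have hsolve : ∀ f, (Matrix.of (A f ω)).det ≠ 0 →
        ((∀ w, (g (f w) ω).normal ⬝ᵥ z = (g (f w) ω).rhs) ↔
          ((Matrix.of (A f ω)).det)⁻¹ • ((Matrix.of (A f ω)).adjugate *ᵥ b f ω) = z) := by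
      intro f hf
      rw [← Matrix.mulVec_eq_iff_of_det_ne_zero hf]
      exact funext_iff.symm
    have hli : ∀ f, LinearIndependent ℝ (fun w => (g (f w) ω).normal) ↔
        (Matrix.of (A f ω)).det ≠ 0 := fun f => by
      rw [← isUnit_iff_ne_zero, ← Matrix.isUnit_iff_isUnit_det,
        ← Matrix.linearIndependent_rows_iff_isUnit]
      rfl
    rw [Set.mem_ofPred_eq, isBasicSolution_iff_exists_family]
    constructor
    · rintro ⟨c, hc, hci, hct⟩
      choose f hfv hfc using fun w => (h ω (c w)).mp (hc w)
      obtain rfl : (fun w => g (f w) ω) = c := funext hfc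
      have hd := (hli f).mp hci
      exact ⟨f, ⟨Set.mem_iInter.mpr hfv, hd⟩, (hsolve f hd).mp hct⟩
    · rintro ⟨f, ⟨hfv, hd⟩, hz⟩
      exact ⟨fun w => g (f w) ω, fun w => (h ω _).mpr ⟨f w, Set.mem_iInter.mp hfv w, rfl⟩,
        (hli f).mpr hd, (hsolve f hd).mpr hz⟩

end LinConstraint

theorem measurable_matrix_mulVec {Ω I K : Type*} [MeasurableSpace Ω] [Fintype K]
    {M : Ω → Matrix I K ℝ} {u : Ω → K → ℝ} (hM : ∀ i k, Measurable fun ω => M ω i k)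
    (hu : Measurable u) : Measurable fun ω => M ω *ᵥ u ω := by
  refine measurable_pi_iff.mpr fun i => ?_
  exact Finset.measurable_sum _ fun k _ => (hM i k).mul ((measurable_pi_apply k).comp hu)

/-- The equations `M α = p` and the sign constraints as a system of inequalities. Only the equality
case of a constraint matters for basic solutions, so the signs of the normals are immaterial. -/
def equationSystem {K I : Type*} [DecidableEq I] (M : Matrix K I ℝ) (p : K → ℝ) :
    Set (LinConstraint I) :=
  (⋃ k, {⟨M k, p k⟩}) ∪ ⋃ i, {⟨Pi.single i 1, 0⟩}

theorem equationBasicSolutions_eq {K I : Type*} [Fintype I] [DecidableEq I] (M : Matrix K I ℝ)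
    (p : K → ℝ) : equationBasicSolutions M p =
      {α | LinConstraint.IsBasicSolution (equationSystem M p) α ∧ M *ᵥ α = p} := by
  ext α
  rw [equationBasicSolutions, Set.mem_ofPred_eq, Set.mem_ofPred_eq, and_comm]
  refine and_congr_left fun hα => ?_
  rw [LinConstraint.isBasicSolution_iff_forall_orthogonal]
  refine forall_congr' fun u => ?_
  rw [← and_imp]
  refine imp_congr_left ?_
  have hM : ∀ k, M k ⬝ᵥ α = p k := congrFun hα
  simp only [equationSystem, Set.mem_union, Set.mem_iUnion, Set.mem_singleton_iff, or_imp,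
    forall_and, forall_exists_index]
  refine and_congr ⟨?_, ?_⟩ ⟨?_, ?_⟩
  · rintro h _ k rfl -
    exact congrFun h k
  · exact fun h => funext fun k => h _ k rfl (hM k)
  · rintro h _ i rfl hi
    simpa using h i (by simpa using hi)
  · intro h i hi
    simpa using h _ i rfl (by simpa using hi)

theorem hasMeasurableEnumeration_equationBasicSolutions {Ω : Type*} [MeasurableSpace Ω]
    {K I : Type} [Countable K] [Fintype I] {M : Ω → Matrix K I ℝ} {p : Ω → K → ℝ}
    (hM : ∀ k i, Measurable fun ω => M ω k i) (hp : Measurable p) :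
    HasMeasurableEnumeration fun ω => equationBasicSolutions (M ω) (p ω) := by
  classical
  simp only [equationBasicSolutions_eq]
  refine (LinConstraint.hasMeasurableEnumeration_isBasicSolution ?_).sep
    (R := {q : Ω × (I → ℝ) | M q.1 *ᵥ q.2 = p q.1}) ?_
  · refine .union (.iUnion fun k => .singleton ?_) (.iUnion fun i => .singleton measurable_const)
    exact LinConstraint.measurable_mk (measurable_pi_iff.mpr (hM k))
      ((measurable_pi_apply k).comp hp)
  · exact measurableSet_eq_fun
      (measurable_matrix_mulVec (fun k i => (hM k i).comp measurable_fst) measurable_snd)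
      (hp.comp measurable_fst)

/-! ### Measurability of feasibility -/

/-- The pairs `(M, b)` for which `M y ≥ b` is solvable form a countable union of closed sets:
bounding `y` makes the projection along `y` closed. -/
theorem measurableSet_exists_le_mulVec {I K : Type*} [Fintype I] [Fintype K] :
    MeasurableSet {q : (I → K → ℝ) × (I → ℝ) | ∃ y : K → ℝ, q.2 ≤ Matrix.of q.1 *ᵥ y} := by
  have hU : {q : (I → K → ℝ) × (I → ℝ) | ∃ y : K → ℝ, q.2 ≤ Matrix.of q.1 *ᵥ y} =
      ⋃ n : ℕ, Prod.snd '' {t : Metric.closedBall (0 : K → ℝ) n × ((I → K → ℝ) × (I → ℝ)) |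
        t.2.2 ≤ Matrix.of t.2.1 *ᵥ t.1.1} := by
    ext q
    simp only [Set.mem_ofPred_eq, Set.mem_iUnion, Set.mem_image, Prod.exists, Subtype.exists]
    constructor
    · rintro ⟨y, hy⟩
      obtain ⟨n, hn⟩ := exists_nat_ge ‖y‖
      exact ⟨n, y, by simpa using hn, q.1, q.2, hy, rfl⟩
    · rintro ⟨n, y, -, M, b, hy, rfl⟩
      exact ⟨y, hy⟩
  rw [hU]
  refine .iUnion fun n => IsClosed.measurableSet ?_
  have : CompactSpace (Metric.closedBall (0 : K → ℝ) n) :=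
    isCompact_iff_compactSpace.mp (isCompact_closedBall _ _)
  refine isClosedMap_snd_of_compactSpace _ (isClosed_le (by fun_prop) ?_)
  exact Continuous.matrix_mulVec (A := fun t : Metric.closedBall (0 : K → ℝ) n ×
    ((I → K → ℝ) × (I → ℝ)) => Matrix.of t.2.1) (by fun_prop) (by fun_prop)

namespace TwoStageLP

variable {Ξ : Type*} {n₁ m₁ n₂ r s : ℕ} (L : TwoStageLP Ξ n₁ m₁ n₂ r s)

/-! ### Eliminating the second-stage values from the Benders system -/

/-- The matrix of the equations `W(ξ)ᵀ α = 0`, `∑_{i random} α i = 1`. -/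
def feasMatrix (ξ : Ξ) : Matrix (Fin n₂ ⊕ Unit) (Fin r ⊕ Fin s) ℝ :=
  Matrix.fromRows (L.W ξ)ᵀ (Matrix.of fun _ => Sum.elim (1 : Fin r → ℝ) (0 : Fin s → ℝ))

/-- The multipliers `α` of the inequalities `αᵀ (h(ξ) - T(ξ) x) ≤ 0` that a scenario contributes
once `Θ` is eliminated: differences of basic solutions of the system defining the optimality cuts,
and basic solutions of the system defining the feasibility cuts. -/
def multipliers (ξ : Ξ) : Set (Fin r ⊕ Fin s → ℝ) :=
  Set.image2 (· - ·) (equationBasicSolutions (L.W ξ)ᵀ (L.q ξ))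
      (equationBasicSolutions (L.W ξ)ᵀ (L.q ξ)) ∪
    equationBasicSolutions (L.feasMatrix ξ) (Sum.elim 0 1)

/-- The inequality `αᵀ (h(ξ) - T(ξ) x) ≤ 0` in the first-stage variables. -/
def multiplierCut (ξ : Ξ) (α : Fin r ⊕ Fin s → ℝ) : LinConstraint (Fin n₁) where
  normal := -((L.T ξ)ᵀ *ᵥ α)
  rhs := -(α ⬝ᵥ L.h ξ)

/-- The system in the first-stage variables alone that arises from the Benders system for the
scenarios `ζ` by eliminating `Θ` between pairs of tight cuts. -/
def reducedSystem {ι : Type*} (ζ : ι → Ξ) : Set (LinConstraint (Fin n₁)) :=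
  (⋃ j, L.multiplierCut (ζ j) '' L.multipliers (ζ j)) ∪ Set.range fun i => ⟨L.A i, L.b i⟩

theorem extremePoints_feasPolyhedron_subset (ξ : Ξ) :
    (L.feasPolyhedron ξ).extremePoints ℝ ⊆
      equationBasicSolutions (L.feasMatrix ξ) (Sum.elim 0 1) := by
  have h : L.feasPolyhedron ξ = {α | 0 ≤ α ∧ L.feasMatrix ξ *ᵥ α =
      Sum.elim (0 : Fin n₂ → ℝ) (1 : Unit → ℝ)} := by
    ext α
    refine and_congr_right fun _ => ?_
    rw [feasMatrix, Matrix.fromRows_mulVec, Sum.elim_eq_iff]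
    refine and_congr_right fun _ => ?_
    simp [funext_iff, Matrix.mulVec, dotProduct]
  rw [h]
  exact extremePoints_subset_equationBasicSolutions _ _

theorem multiplierCut_sub_normal_dotProduct {ξ : Ξ} {α β : Fin r ⊕ Fin s → ℝ}
    {x : Fin n₁ → ℝ} :
    (L.multiplierCut ξ (α - β)).normal ⬝ᵥ x =
      (L.multiplierCut ξ α).normal ⬝ᵥ x - (L.multiplierCut ξ β).normal ⬝ᵥ x := by
  simp only [multiplierCut, Matrix.mulVec_sub, neg_dotProduct, sub_dotProduct]
  ring

/-- Projection of a basic solution to the first-stage variables: a direction `u` orthogonal to the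
tight reduced constraints lifts to a direction `(u, w)` orthogonal to the tight Benders constraints,
`w j` being the change of the optimality cuts of scenario `j` that are tight; all of them change
equally along `u`. -/
theorem isBasicSolution_reducedSystem {N : ℕ} {ξs : Fin N → Ξ} {x : Fin n₁ → ℝ} {Θ : Fin N → ℝ}
    (h : LinConstraint.IsBasicSolution (L.bendersSystem ξs) (Sum.elim x Θ)) :
    LinConstraint.IsBasicSolution (L.reducedSystem ξs) x := by
  classical
  rw [LinConstraint.isBasicSolution_iff_forall_orthogonal] at h ⊢
  intro u hu
  have hcut : ∀ j α (y : Fin n₁ → ℝ) (w : Fin N → ℝ),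
      (L.optCut j (ξs j) α).normal ⬝ᵥ Sum.elim y w =
        (L.multiplierCut (ξs j) α).normal ⬝ᵥ y - w j := fun j α y w => by
    rw [optCut, sumElim_dotProduct_sumElim, neg_dotProduct (Pi.single j 1), single_dotProduct,
      one_mul, ← sub_eq_add_neg]
    rfl
  let IsTight : Fin N → (Fin r ⊕ Fin s → ℝ) → Prop := fun j α =>
    α ∈ equationBasicSolutions (L.W (ξs j))ᵀ (L.q (ξs j)) ∧
      (L.multiplierCut (ξs j) α).normal ⬝ᵥ x - Θ j = -(α ⬝ᵥ L.h (ξs j))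
  obtain ⟨w, hw⟩ : ∃ w : Fin N → ℝ, ∀ j α, IsTight j α →
      (L.multiplierCut (ξs j) α).normal ⬝ᵥ u = w j := by
    have : ∀ j, ∃ t : ℝ, ∀ α, IsTight j α →
        (L.multiplierCut (ξs j) α).normal ⬝ᵥ u = t := fun j => by
      by_cases hj : ∃ β, IsTight j β
      · obtain ⟨β, hβ, hβt⟩ := hj
        refine ⟨(L.multiplierCut (ξs j) β).normal ⬝ᵥ u, fun α hα => ?_⟩
        have := hu (L.multiplierCut (ξs j) (α - β)) (Or.inl (Set.mem_iUnion.mpr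
          ⟨j, _, Or.inl ⟨α, hα.1, β, hβ, rfl⟩, rfl⟩)) (by
            rw [multiplierCut_sub_normal_dotProduct]
            have hr : (L.multiplierCut (ξs j) (α - β)).rhs =
                -(α ⬝ᵥ L.h (ξs j)) + β ⬝ᵥ L.h (ξs j) := by
              rw [multiplierCut, sub_dotProduct]
              ring
            rw [hr]
            linarith [hα.2])
        rw [multiplierCut_sub_normal_dotProduct] at this
        linarith
      · exact ⟨0, fun α hα => (hj ⟨α, hα⟩).elim⟩
    choose w hw using this
    exact ⟨w, hw⟩
  have h0 := h (Sum.elim u w) (by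
    rintro k ((⟨j, α, hα, rfl⟩ | ⟨j, α, hα, rfl⟩) | ⟨i, rfl⟩) ht
    · rw [hcut] at ht ⊢
      rw [hw j α ⟨extremePoints_subset_equationBasicSolutions _ _ hα, ht⟩, sub_self]
    · have hf : ∀ y (w : Fin N → ℝ), (L.feasCut N (ξs j) α).normal ⬝ᵥ Sum.elim y w =
          (L.multiplierCut (ξs j) α).normal ⬝ᵥ y := fun y w => by
        rw [feasCut, sumElim_dotProduct_sumElim, zero_dotProduct, add_zero]
        rfl
      rw [hf] at ht ⊢
      exact hu _ (Or.inl (Set.mem_iUnion.mpr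
        ⟨j, α, Or.inr (L.extremePoints_feasPolyhedron_subset _ hα), rfl⟩)) ht
    · rw [firstStageCut, sumElim_dotProduct_sumElim, zero_dotProduct, add_zero] at ht ⊢
      exact hu ⟨L.A i, L.b i⟩ (Or.inr ⟨i, rfl⟩) ht)
  exact funext fun i => congrFun h0 (Sum.inl i)

/-- Since each reduced constraint involves at most one scenario, `n₁` scenarios suffice to make
`x` a basic solution. -/
theorem exists_isBasicSolution_reducedSystem_restrict {N : ℕ} (hN : n₁ ≤ N) {ξs : Fin N → Ξ}
    {x : Fin n₁ → ℝ} (h : LinConstraint.IsBasicSolution (L.reducedSystem ξs) x) :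
    ∃ J : Finset (Fin N), J.card = n₁ ∧
      LinConstraint.IsBasicSolution (L.reducedSystem fun j : {j // j ∈ J} => ξs j) x := by
  classical
  obtain ⟨c, hc, hli, ht⟩ := (LinConstraint.isBasicSolution_iff_exists_family _ _).mp h
  have hc' : ∀ i, ∃ I : Finset (Fin N), I.card ≤ 1 ∧ ∀ J : Finset (Fin N), I ⊆ J →
      c i ∈ L.reducedSystem fun j : {j // j ∈ J} => ξs j := by
    intro i
    rcases hc i with hi | hi
    · obtain ⟨j, hj⟩ := Set.mem_iUnion.mp hi
      exact ⟨{j}, by simp, fun J hJ => Or.inl (Set.mem_iUnion.mpr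
        ⟨⟨j, hJ (Finset.mem_singleton_self j)⟩, hj⟩)⟩
    · exact ⟨∅, by simp, fun J _ => Or.inr hi⟩
  choose I hI hIJ using hc'
  obtain ⟨J, hJ, hcard⟩ := Finset.exists_superset_card_eq (n := n₁) (s := Finset.univ.biUnion I)
    (by simpa using Finset.card_biUnion_le_card_mul Finset.univ I 1 fun i _ => hI i)
    (by simpa using hN)
  exact ⟨J, hcard, (LinConstraint.isBasicSolution_iff_exists_family _ _).mpr
    ⟨c, fun i => hIJ i J ((Finset.subset_biUnion_of_mem I (Finset.mem_univ i)).trans hJ), hli, ht⟩⟩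

/-! ### Counting candidate solutions -/

/-- With `M = m₂ ^ (n₂ + 1) / (n₂ + 1)!`, a scenario contributes at most `M ^ 2` differences and
`M ≤ M ^ 2` feasibility multipliers. -/
theorem finite_multipliers_and_ncard_le (hm₂ : n₂ + 1 ≤ r + s) (ξ : Ξ) :
    (L.multipliers ξ).Finite ∧ ((L.multipliers ξ).ncard : ℝ) ≤
      2 * (((r + s : ℕ) : ℝ) ^ (n₂ + 1) / ((n₂ + 1).factorial : ℝ)) ^ 2 := by
  obtain ⟨ho, hoc⟩ := finite_equationBasicSolutions_and_ncard_le (L.W ξ)ᵀ (L.q ξ)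
    (l := n₂ + 1) (by simp) (by simpa using hm₂)
  obtain ⟨hf, hfc⟩ := finite_equationBasicSolutions_and_ncard_le (L.feasMatrix ξ) (Sum.elim 0 1)
    (l := n₂ + 1) (by simp) (by simpa using hm₂)
  have hM : (1 : ℝ) ≤ ((r + s : ℕ) : ℝ) ^ (n₂ + 1) / ((n₂ + 1).factorial : ℝ) := by
    simpa using pow_div_factorial_mono_of_le (Nat.zero_le (n₂ + 1)) hm₂
  rw [Fintype.card_sum, Fintype.card_fin, Fintype.card_fin] at hoc hfc
  set M := ((r + s : ℕ) : ℝ) ^ (n₂ + 1) / ((n₂ + 1).factorial : ℝ)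
  refine ⟨(ho.image2 _ ho).union hf, ?_⟩
  have h1 : (L.multipliers ξ).ncard ≤
      (equationBasicSolutions (L.W ξ)ᵀ (L.q ξ)).ncard *
        (equationBasicSolutions (L.W ξ)ᵀ (L.q ξ)).ncard +
      (equationBasicSolutions (L.feasMatrix ξ) (Sum.elim 0 1)).ncard := by
    refine (Set.ncard_union_le _ _).trans (Nat.add_le_add_right ?_ _)
    rw [← Set.image_prod, ← Set.ncard_prod]
    exact Set.ncard_image_le (ho.prod ho)
  calc ((L.multipliers ξ).ncard : ℝ)
      ≤ (equationBasicSolutions (L.W ξ)ᵀ (L.q ξ)).ncard *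
          (equationBasicSolutions (L.W ξ)ᵀ (L.q ξ)).ncard +
        (equationBasicSolutions (L.feasMatrix ξ) (Sum.elim 0 1)).ncard := by exact_mod_cast h1
    _ ≤ M * M + M := by gcongr
    _ ≤ 2 * M ^ 2 := by nlinarith

theorem finite_reducedSystem_and_ncard_le (hm₂ : n₂ + 1 ≤ r + s) {ι : Type*} [Fintype ι]
    (ζ : ι → Ξ) : (L.reducedSystem ζ).Finite ∧ ((L.reducedSystem ζ).ncard : ℝ) ≤
      (2 * (Fintype.card ι : ℝ) + m₁) *
        (((r + s : ℕ) : ℝ) ^ (n₂ + 1) / ((n₂ + 1).factorial : ℝ)) ^ 2 := by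
  have hM : (1 : ℝ) ≤ ((r + s : ℕ) : ℝ) ^ (n₂ + 1) / ((n₂ + 1).factorial : ℝ) := by
    simpa using pow_div_factorial_mono_of_le (Nat.zero_le (n₂ + 1)) hm₂
  have hmul := fun j => L.finite_multipliers_and_ncard_le hm₂ (ζ j)
  set M := ((r + s : ℕ) : ℝ) ^ (n₂ + 1) / ((n₂ + 1).factorial : ℝ)
  refine ⟨(Set.finite_iUnion fun j => (hmul j).1.image _).union (Set.finite_range _), ?_⟩
  have h1 : (L.reducedSystem ζ).ncard ≤ ∑ j, (L.multipliers (ζ j)).ncard + m₁ := by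
    refine (Set.ncard_union_le _ _).trans (Nat.add_le_add ?_ ?_)
    · refine (Set.ncard_iUnion_le_of_fintype _).trans (Finset.sum_le_sum fun j _ => ?_)
      exact Set.ncard_image_le (hmul j).1
    · rw [← Set.image_univ]
      refine (Set.ncard_image_le Set.finite_univ).trans ?_
      rw [Set.ncard_univ, Nat.card_fin]
  calc ((L.reducedSystem ζ).ncard : ℝ)
      ≤ ∑ j, ((L.multipliers (ζ j)).ncard : ℝ) + m₁ := by exact_mod_cast h1
    _ ≤ ∑ _j : ι, 2 * M ^ 2 + m₁ * M ^ 2 := by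
        refine add_le_add (Finset.sum_le_sum fun j _ => (hmul j).2) ?_
        exact le_mul_of_one_le_right (by positivity) (one_le_pow₀ hM)
    _ = _ := by
        rw [Finset.sum_const, Finset.card_univ, nsmul_eq_mul]
        ring

/-! ### Measurability of the candidate solutions and of feasibility -/

/-- The infimum defining `Q` is below `⊤` as soon as it ranges over a nonempty set, whether or not
it is attained. -/
theorem Q_lt_top_iff (x : Fin n₁ → ℝ) (ξ : Ξ) :
    L.Q x ξ < ⊤ ↔ ∃ y, L.h ξ - L.T ξ *ᵥ x ≤ L.W ξ *ᵥ y := by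
  simp [Q, iInf_lt_iff, EReal.coe_lt_top]

theorem F_lt_top_iff (x : Fin n₁ → ℝ) (ξ : Ξ) : L.F x ξ < ⊤ ↔ L.Q x ξ < ⊤ := by
  rw [F, lt_top_iff_ne_top, lt_top_iff_ne_top, Ne, Ne, not_iff_not]
  induction L.Q x ξ using EReal.rec <;> simp [← EReal.coe_add]

section

variable [MeasurableSpace Ξ]

variable {L} in
theorem MeasurableData.measurable_W (hL : L.MeasurableData) (i k) :
    Measurable fun ξ => L.W ξ i k := by
  rcases i with i | i
  · exact hL.Wbar i k
  · exact measurable_const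

variable {L} in
theorem MeasurableData.measurable_T (hL : L.MeasurableData) (i k) :
    Measurable fun ξ => L.T ξ i k := by
  rcases i with i | i
  · exact hL.Tbar i k
  · exact measurable_const

variable {L} in
theorem MeasurableData.measurable_h (hL : L.MeasurableData) : Measurable L.h := by
  refine measurable_pi_iff.mpr ?_
  rintro (i | i)
  · exact hL.hbar i
  · exact measurable_const

theorem hasMeasurableEnumeration_multipliers (hL : L.MeasurableData) :
    HasMeasurableEnumeration L.multipliers := by
  have ho : HasMeasurableEnumeration fun ξ => equationBasicSolutions (L.W ξ)ᵀ (L.q ξ) :=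
    hasMeasurableEnumeration_equationBasicSolutions (fun k i => hL.measurable_W i k)
      (measurable_pi_iff.mpr hL.q)
  refine .union ?_ (hasMeasurableEnumeration_equationBasicSolutions ?_ measurable_const)
  · have := ho.bind ((ho.comp measurable_fst).image
      (f := fun q : (Ξ × (Fin r ⊕ Fin s → ℝ)) × (Fin r ⊕ Fin s → ℝ) => q.1.2 - q.2)
      ((measurable_snd.comp measurable_fst).sub measurable_snd))
    simpa only [Set.image2, Set.image, Set.mem_ofPred_eq] using this
  · rintro (k | k) i
    · exact hL.measurable_W i k
    · exact measurable_const

theorem hasMeasurableEnumeration_isBasicSolution_reducedSystem (hL : L.MeasurableData)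
    {ι : Type} [Countable ι] :
    HasMeasurableEnumeration fun ζ : ι → Ξ =>
      {x | LinConstraint.IsBasicSolution (L.reducedSystem ζ) x} := by
  refine LinConstraint.hasMeasurableEnumeration_isBasicSolution (.union (.iUnion fun j => ?_) ?_)
  · refine ((L.hasMeasurableEnumeration_multipliers hL).comp (measurable_pi_apply j)).image
      (f := fun q : (ι → Ξ) × (Fin r ⊕ Fin s → ℝ) => L.multiplierCut (q.1 j) q.2) ?_
    have hj : Measurable fun q : (ι → Ξ) × (Fin r ⊕ Fin s → ℝ) => q.1 j :=
      (measurable_pi_apply j).comp measurable_fst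
    refine LinConstraint.measurable_mk ?_ ?_
    · exact (measurable_matrix_mulVec (fun i k => (hL.measurable_T k i).comp hj)
        measurable_snd).neg
    · refine (Finset.measurable_sum _ fun i _ => ?_).neg
      exact ((measurable_pi_apply i).comp measurable_snd).mul
        ((measurable_pi_apply i).comp (hL.measurable_h.comp hj))
  · simp only [← Set.iUnion_singleton_eq_range]
    exact .iUnion fun i => .singleton measurable_const

theorem measurableSet_F_lt_top (hL : L.MeasurableData) :
    MeasurableSet {q : (Fin n₁ → ℝ) × Ξ | L.F q.1 q.2 < ⊤} := by
  simp only [F_lt_top_iff, Q_lt_top_iff]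
  have hW : Measurable fun q : (Fin n₁ → ℝ) × Ξ => fun i k => L.W q.2 i k :=
    measurable_pi_iff.mpr fun i => measurable_pi_iff.mpr fun k =>
      (hL.measurable_W i k).comp measurable_snd
  have hv : Measurable fun q : (Fin n₁ → ℝ) × Ξ => L.h q.2 - L.T q.2 *ᵥ q.1 :=
    (hL.measurable_h.comp measurable_snd).sub (measurable_matrix_mulVec
      (fun i k => (hL.measurable_T i k).comp measurable_snd) measurable_fst)
  exact (hW.prodMk hv) measurableSet_exists_le_mulVec

theorem measurable_recourseLikelihood (hL : L.MeasurableData) (P : Measure Ξ) [SFinite P] :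
    Measurable (L.recourseLikelihood P) :=
  (measurable_measure_prodMk_left (L.measurableSet_F_lt_top hL)).ennreal_toReal

/-! ### The failure probability -/

/-- The probability that the scenarios in `J` produce a candidate of recourse likelihood below
`1 - ε` for which the remaining, independent, scenarios are feasible nevertheless. -/
theorem measure_exists_candidate_le (hL : L.MeasurableData) (P : Measure Ξ)
    [IsProbabilityMeasure P] {N : ℕ} (J : Finset (Fin N)) {ε : ℝ} (hε : ε < 1) {K : ℕ}
    (hK : ∀ ζ : {j // j ∈ J} → Ξ, (L.reducedSystem ζ).Finite ∧ (L.reducedSystem ζ).ncard ≤ K) :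
    (Measure.pi fun _ : Fin N => P) {ξs | ∃ x,
        LinConstraint.IsBasicSolution (L.reducedSystem fun j : {j // j ∈ J} => ξs j) x ∧
        L.recourseLikelihood P x < 1 - ε ∧ ∀ j ∉ J, L.F x (ξs j) < ⊤} ≤
      (K.choose n₁ : ℕ) * ENNReal.ofReal ((1 - ε) ^ (N - J.card)) := by
  classical
  let R : Set ((Fin n₁ → ℝ) × ({j // j ∉ J} → Ξ)) :=
    {q | L.recourseLikelihood P q.1 < 1 - ε ∧ ∀ j, L.F q.1 (q.2 j) < ⊤}
  have hR : MeasurableSet R := by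
    have hR' : R = {q | L.recourseLikelihood P q.1 < 1 - ε} ∩
        ⋂ j, (fun q => (q.1, q.2 j)) ⁻¹' {q | L.F q.1 q.2 < ⊤} := by
      ext q
      simp [R]
    rw [hR']
    refine (measurableSet_lt ((L.measurable_recourseLikelihood hL P).comp measurable_fst)
      measurable_const).inter (.iInter fun j => ?_)
    exact (measurable_fst.prodMk ((measurable_pi_apply j).comp measurable_snd))
      (L.measurableSet_F_lt_top hL)
  have hδ : ∀ x, (Measure.pi fun _ : {j // j ∉ J} => P) {η | (x, η) ∈ R} ≤
      ENNReal.ofReal ((1 - ε) ^ (N - J.card)) := by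
    intro x
    by_cases hx : L.recourseLikelihood P x < 1 - ε
    · have hset : {η | (x, η) ∈ R} =
          Set.univ.pi fun _ : {j // j ∉ J} => {ξ | L.F x ξ < ⊤} := by
        ext η
        simp [R, hx]
      have hc : Fintype.card {j // j ∉ J} = N - J.card := by
        simp [Fintype.card_subtype_compl]
      rw [hset, Measure.pi_pi, Finset.prod_const, Finset.card_univ, hc,
        ENNReal.ofReal_pow (by linarith)]
      gcongr
      exact (ENNReal.le_ofReal_iff_toReal_le (measure_ne_top _ _) (by linarith)).mpr hx.le
    · simp [R, hx]
  have hmp : MeasurePreserving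
      (MeasurableEquiv.piEquivPiSubtypeProd (fun _ : Fin N => Ξ) (· ∈ J))
      (Measure.pi fun _ => P) ((Measure.pi fun _ : {j // j ∈ J} => P).prod
        (Measure.pi fun _ : {j // j ∉ J} => P)) := by
    convert measurePreserving_piEquivPiSubtypeProd (fun _ : Fin N => P) (· ∈ J)
  have hcand := L.hasMeasurableEnumeration_isBasicSolution_reducedSystem hL (ι := {j // j ∈ J})
  refine le_of_eq_of_le ?_ (prod_setOf_exists_le (Measure.pi fun _ : {j // j ∈ J} => P)
    (Measure.pi fun _ : {j // j ∉ J} => P) hcand hR (K := K.choose n₁) (fun ζ => ?_) hδ)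
  · rw [← hmp.measure_preimage_equiv]
    congr 1
    ext ξs
    simp [R, MeasurableEquiv.piEquivPiSubtypeProd]
  · obtain ⟨h1, h2⟩ := LinConstraint.finite_isBasicSolution_and_ncard_le (hK ζ).1
    refine ⟨h1, h2.trans ?_⟩
    rw [Fintype.card_fin]
    exact Nat.choose_le_choose _ (hK ζ).2

end

end TwoStageLP

theorem mainTheorem1 {Ξ : Type*} [MeasurableSpace Ξ] (P : Measure Ξ) [IsProbabilityMeasure P]
    {n₁ m₁ n₂ r s : ℕ} (L : TwoStageLP Ξ n₁ m₁ n₂ r s) (hL : L.MeasurableData)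
    (hm₂ : n₂ + 1 ≤ r + s)
    (hdet : ∀ x ∈ L.X, ∃ y : Fin n₂ → ℝ, L.d - L.C *ᵥ x ≤ L.D *ᵥ y)
    (N : ℕ) (hN : n₁ ≤ N) (ε : ℝ) (hε0 : 0 < ε) (hε1 : ε < 1)
    (xstar : (Fin N → Ξ) → (Fin n₁ → ℝ))
    (hxstar : ∀ᵐ ξs ∂(Measure.pi fun _ : Fin N => P), L.IsSAABasicOptimal ξs (xstar ξs)) :
    1 - saaFailureBound N n₁ m₁ n₂ (r + s) ε ≤
        (Measure.pi fun _ : Fin N => P).real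
          {ξs | 1 - ε ≤ L.recourseLikelihood P (xstar ξs)} ∧
      (Measure.pi fun _ : Fin N => P).real
          {ξs | L.recourseLikelihood P (xstar ξs) < 1 - ε} ≤
        saaFailureBound N n₁ m₁ n₂ (r + s) ε := by
  set μ := Measure.pi fun _ : Fin N => P
  set M : ℝ := ((r + s : ℕ) : ℝ) ^ (n₂ + 1) / ((n₂ + 1).factorial : ℝ) with hM
  set bad : Set (Fin N → Ξ) := {ξs | L.recourseLikelihood P (xstar ξs) < 1 - ε}
  -- an upper bound for the number of constraints that `n₁` scenarios contribute
  let K : ℕ := ⌊(2 * (n₁ : ℝ) + m₁) * M ^ 2⌋₊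
  let badCandidate : Finset (Fin N) → Set (Fin N → Ξ) := fun J => {ξs | ∃ x,
    LinConstraint.IsBasicSolution (L.reducedSystem fun j : {j // j ∈ J} => ξs j) x ∧
    L.recourseLikelihood P x < 1 - ε ∧ ∀ j ∉ J, L.F x (ξs j) < ⊤}
  let 𝒥 : Finset (Finset (Fin N)) := Finset.univ.powersetCard n₁
  have hbad : μ bad ≤ μ (⋃ J ∈ 𝒥, badCandidate J) := by
    refine measure_mono_ae ?_
    filter_upwards [hxstar] with ξs hopt hξs
    obtain ⟨Θ, hΘ, hbasic, -⟩ := hopt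
    obtain ⟨J, hJ, hx⟩ := L.exists_isBasicSolution_reducedSystem_restrict hN
      (L.isBasicSolution_reducedSystem hbasic)
    refine Set.mem_biUnion (x := J) (by simpa [𝒥, Finset.mem_powersetCard] using hJ) ?_
    exact ⟨_, hx, hξs, fun j _ => by rw [L.F_lt_top_iff, hΘ]; exact EReal.coe_lt_top _⟩
  have hle : μ bad ≤ ENNReal.ofReal ((N.choose n₁ : ℝ) * (K.choose n₁ * (1 - ε) ^ (N - n₁))) := by
    have hJ : ∀ J ∈ 𝒥, μ (badCandidate J) ≤
        (K.choose n₁ : ℕ) * ENNReal.ofReal ((1 - ε) ^ (N - n₁)) := by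
      intro J hJ
      have hcard : J.card = n₁ := (Finset.mem_powersetCard.mp hJ).2
      have := L.measure_exists_candidate_le hL P J hε1 (K := K) fun ζ => by
        obtain ⟨h1, h2⟩ := L.finite_reducedSystem_and_ncard_le hm₂ ζ
        rw [Fintype.card_coe, hcard] at h2
        exact ⟨h1, Nat.le_floor h2⟩
      rwa [hcard] at this
    have h1 := hbad.trans ((measure_biUnion_finset_le _ _).trans
      (Finset.sum_le_card_nsmul _ _ _ hJ))
    rw [Finset.card_powersetCard, Finset.card_univ, Fintype.card_fin, nsmul_eq_mul] at h1
    rwa [ENNReal.ofReal_mul (by positivity), ENNReal.ofReal_mul (by positivity),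
      ENNReal.ofReal_natCast, ENNReal.ofReal_natCast]
  have hε : 0 < 1 - ε := by linarith
  have hfail : μ.real bad ≤ saaFailureBound N n₁ m₁ n₂ (r + s) ε := by
    refine (ENNReal.toReal_le_of_le_ofReal (by positivity) hle).trans ?_
    have hK : (K.choose n₁ : ℝ) ≤ ((2 * (n₁ : ℝ) + m₁) * M ^ 2) ^ n₁ / (n₁.factorial : ℝ) := by
      refine (Nat.choose_le_pow_div _ _).trans ?_
      gcongr
      exact Nat.floor_le (by positivity)
    calc (N.choose n₁ : ℝ) * (K.choose n₁ * (1 - ε) ^ (N - n₁))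
        ≤ N.choose n₁ * (((2 * (n₁ : ℝ) + m₁) * M ^ 2) ^ n₁ / (n₁.factorial : ℝ) *
            (1 - ε) ^ (N - n₁)) := by gcongr
      _ = saaFailureBound N n₁ m₁ n₂ (r + s) ε := by
        rw [saaFailureBound, ← hM, mul_pow, ← pow_mul]
        ring
  refine ⟨?_, hfail⟩
  -- `xstar` need not be measurable, so only subadditivity of the outer measure is available
  have hcover : (1 : ℝ) ≤ μ.real {ξs | 1 - ε ≤ L.recourseLikelihood P (xstar ξs)} + μ.real bad := by
    refine le_trans ?_ (measureReal_union_le _ _)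
    rw [show {ξs | 1 - ε ≤ L.recourseLikelihood P (xstar ξs)} ∪ bad = Set.univ from
      Set.eq_univ_of_forall fun ξs =>
        le_or_gt (1 - ε) (L.recourseLikelihood P (xstar ξs)), probReal_univ]
  linarith
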